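/- Let $(X,d)$ be a nonempty compact metric space and $c:X\times X\to\mathbb R$ a continuous function. For a bounded function $f:X\to\mathbb R$ put $T^-f(x)=\inf_{y\in X}\big(f(y)+c(y,x)\big)$. There is a unique real number $c[0]$ for which the equation $u=T^-u+c[0]$ has a bounded solution $u:X\to\mathbb R$ (the solutions are called weak KAM solutions), and for every $\lambda\in(0,1)$ there is a unique bounded function $u_\lambda:X\to\mathbb R$ with $u_\lambda=T^-(\lambda u_\lambda)$. A Mather measure is a Borel probability measure $\mu$ on $X\times X$ whose two marginals agree, $\pi_{1*}\mu=\pi_{2*}\mu$, and such that $\int_{X\times X}c\,d\mu=-c[0]$. Let $\mathcal F$ be the set of continuous functions $w:X\to\mathbb R$ such that $w(y)-w(x)\le c(x,y)+c[0]$ for all $x,y\in X$ and $\int_X w\,d\pi_{1*}\mu\le 0$ for every Mather measure $\mu$. For $n\ge 1$ let $c_n(x,y)$ be the infimum of $\sum_{i=0}^{n-1}c(x_i,x_{i+1})$ over all $(x_0,\dots,x_n)\in X^{n+1}$ with $x_0=x$, $x_n=y$, and let $h(x,y)=\liminf_{n\to+\infty}\big(c_n(x,y)+n\,c[0]\big)$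 (the Peierls barrier). Then there is a weak KAM solution $u_1$ such that $u_\lambda+\frac{c[0]}{1-\lambda}\to u_1$ uniformly on $X$ as $\lambda\to1$, $\lambda<1$. Moreover, for every $x\in X$, $$u_1(x)=\sup_{w\in\mathcal F}w(x)=\min_{\mu}\int_X h(y,x)\,d\pi_{1*}\mu(y),$$ where the minimum is taken over all Mather measures $\mu$ and is attained, and $h(\cdot,x)$ is $\pi_{1*}\mu$-integrable for every Mather measure $\mu$. -/

import Mathlib

open Set Filter Topology MeasureTheory

namespace WeakKAM

/-- `f` belongs to the space of bounded real functions on `X` (no continuity is required). -/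
def IsBoundedFun {X : Type*} (f : X → ℝ) : Prop :=
  ∃ K : ℝ, ∀ x, |f x| ≤ K

/-- The negative Lax-Oleinik operator `T⁻ f (x) = inf_y (f y + c (y, x))`, to be applied to
bounded functions `f`. -/
noncomputable def laxOleinik {X : Type*} (c : X × X → ℝ) (f : X → ℝ) : X → ℝ :=
  fun x => ⨅ y, (f y + c (y, x))

/-- `u` is a (bounded) solution of `u = T⁻ u + C`. With `C` the critical value these are the
weak KAM solutions. On a compact space with continuous cost a solution is
automatically bounded: `T⁻ u` is `-∞` if `u` is unbounded below, and bounded otherwise. -/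
def IsWeakKAMSolution {X : Type*} (c : X × X → ℝ) (C : ℝ) (u : X → ℝ) : Prop :=
  IsBoundedFun u ∧ ∀ x, u x = laxOleinik c u x + C

/-- `C` is a critical value: the equation `u = T⁻ u + C` has a solution. -/
def IsCriticalValue {X : Type*} (c : X × X → ℝ) (C : ℝ) : Prop :=
  ∃ u : X → ℝ, IsWeakKAMSolution c C u

/-- `u` is a bounded fixed point of the discounted operator `f ↦ T⁻ (lam f)`. -/
def IsDiscountedSolution {X : Type*} (c : X × X → ℝ) (lam : ℝ) (u : X → ℝ) : Prop :=
  IsBoundedFun u ∧ u = laxOleinik c (fun y => lam * u y)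

/-- `C`-subsolutions. -/
def IsSubsolution {X : Type*} (c : X × X → ℝ) (C : ℝ) (v : X → ℝ) : Prop :=
  ∀ x y, v y - v x ≤ c (x, y) + C

/-- `c_n (x, y)`: the infimum of the costs of the chains `x = z 0, z 1, …, z n = y` (only the
first `n + 1` terms of the sequence `z` matter), for `n > 0`. -/
noncomputable def chainCost {X : Type*} (c : X × X → ℝ) (n : ℕ) (x y : X) : ℝ :=
  sInf {s : ℝ | ∃ z : ℕ → X, z 0 = x ∧ z n = y ∧
    s = ∑ i ∈ Finset.range n, c (z i, z (i + 1))}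

/-- The Peierls barrier `h (x, y) = liminf_n (c_n (x, y) + n C)`, `C` being the critical value. -/
noncomputable def peierlsBarrier {X : Type*} (c : X × X → ℝ) (C : ℝ) (x y : X) : ℝ :=
  liminf (fun n : ℕ => chainCost c n x y + n * C) atTop

/-- Mather measures (`C` being the critical value): Borel probability measures on `X × X` which
are closed, that is, have equal marginals, and for which the integral of `c` is `-C`. -/
structure IsMatherMeasure {X : Type*} [MeasurableSpace X] (c : X × X → ℝ) (C : ℝ)
    (μ : Measure (X × X)) : Prop where
  isProbabilityMeasure : IsProbabilityMeasure μ
  closed : μ.map Prod.fst = μ.map Prod.snd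
  minimizing : ∫ p, c p ∂μ = -C

/-- Continuous critical subsolutions whose integral against the first marginal of every Mather
measure is nonpositive. -/
def constrainedSubsolutions {X : Type*} [TopologicalSpace X] [MeasurableSpace X]
    (c : X × X → ℝ) (C : ℝ) : Set (X → ℝ) :=
  {w | Continuous w ∧ IsSubsolution c C w ∧
    ∀ μ : Measure (X × X), IsMatherMeasure c C μ → ∫ x, w x ∂(μ.map Prod.fst) ≤ 0}

end WeakKAM

/-! Adding `C / (1 - lam)` turns `u_lam` into a solution `v_lam` of `v = T⁻ (lam v) + C`. Comparison
with one weak KAM solution bounds `v_lam` uniformly in `lam`, and the modulus of `c` makes the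
family equicontinuous. So limits exist along every ultrafilter finer than `lam → 1`, and each is a
weak KAM solution.

All these limits coincide with the greatest constrained subsolution. A limit is constrained, because
integrating `v y - lam * v x ≤ c (x, y) + C` against a Mather measure leaves `(1 - lam) ∫ v ≤ 0`
(`IsMatherMeasure.integral_nonpos`). It dominates the others, because discounted occupation measures
of calibrated backward orbits from `x` accumulate at a Mather measure `μ` with `w x - ∫ w ≤ u x` for
every continuous subsolution `w`, the integral being against the first marginal
(`exists_isMatherMeasure_le`).

For the barrier formula, integrating `u x - u y ≤ h (y, x)` gives one inequality. For attainment,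
`exists_aubry_calibrated` gives `y` with `h (y, y) ≤ 0` and `u y + h (y, x) ≤ u x`. The subsolution
`-h (·, y)`, tested on the measure built at `y`, gives `∫ h (·, y) ≤ u y`, and the triangle
inequality carries this to `x`. -/

namespace WeakKAM

/-! ### The Lax-Oleinik operator and comparison -/

section Operator

instance neBot_comap_nhdsLT_one :
    (comap ((↑) : Ioo (0 : ℝ) 1 → ℝ) (𝓝[<] 1)).NeBot :=
  comap_coe_neBot_of_le_principal (le_principal_iff.2 (Ioo_mem_nhdsLT zero_lt_one))

/-- Ultrafilters replace subsequences: bounded families converge at all points of `X` at once, with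
no diagonal extraction. -/
lemma exists_tendsto_of_abs_le {ι : Type*} (l : Ultrafilter ι) {g : ι → ℝ} {K : ℝ}
    (h : ∀ i, |g i| ≤ K) : ∃ t, Tendsto g l (𝓝 t) := by
  obtain ⟨t, -, ht⟩ := (isCompact_Icc (a := -K) (b := K)).ultrafilter_le_nhds (l.map g)
    (by
      rw [le_principal_iff]
      exact Filter.mem_map.2 (univ_mem' fun i => abs_le.1 (h i)))
  exact ⟨t, ht⟩

variable {X : Type*} {c : X × X → ℝ} {f u w : X → ℝ} {lam C C' : ℝ}

/-- `u` is a bounded solution of `u = T⁻ (lam u) + C`. The weak KAM equation is the case `lam = 1`,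
the discounted equation the case `C = 0`. -/
def IsSolution (c : X × X → ℝ) (lam C : ℝ) (u : X → ℝ) : Prop :=
  IsBoundedFun u ∧ ∀ x, u x = laxOleinik c (fun y => lam * u y) x + C

lemma isSolution_one_iff : IsSolution c 1 C u ↔ IsWeakKAMSolution c C u := by
  simp [IsSolution, IsWeakKAMSolution]

lemma isSolution_zero_iff : IsSolution c lam 0 u ↔ IsDiscountedSolution c lam u := by
  simp [IsSolution, IsDiscountedSolution, funext_iff]

lemma IsBoundedFun.const_mul (hf : IsBoundedFun f) (a : ℝ) : IsBoundedFun fun y => a * f y := by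
  obtain ⟨K, hK⟩ := hf
  refine ⟨|a| * K, fun x => ?_⟩
  rw [abs_mul]
  exact mul_le_mul_of_nonneg_left (hK x) (abs_nonneg a)

lemma IsBoundedFun.add_const (hf : IsBoundedFun f) (a : ℝ) : IsBoundedFun fun y => f y + a := by
  obtain ⟨K, hK⟩ := hf
  exact ⟨K + |a|, fun x => (abs_add_le _ _).trans (by linarith [hK x])⟩

lemma IsBoundedFun.of_continuous [TopologicalSpace X] [CompactSpace X] (hf : Continuous f) :
    IsBoundedFun f := by
  obtain ⟨K, hK⟩ := isCompact_univ.exists_bound_of_continuousOn hf.continuousOn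
  exact ⟨K, fun x => by simpa using hK x (mem_univ x)⟩

lemma laxOleinik_le (hc : IsBoundedFun c) (hf : IsBoundedFun f) (x y : X) :
    laxOleinik c f x ≤ f y + c (y, x) := by
  obtain ⟨K, hK⟩ := hc
  obtain ⟨L, hL⟩ := hf
  refine ciInf_le ⟨-L - K, ?_⟩ y
  rintro _ ⟨z, rfl⟩
  have := abs_le.1 (hK (z, x))
  have := abs_le.1 (hL z)
  dsimp only
  linarith

lemma le_laxOleinik [Nonempty X] {a : ℝ} {x : X} (h : ∀ y, a ≤ f y + c (y, x)) :
    a ≤ laxOleinik c f x :=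
  le_ciInf h

lemma laxOleinik_mul_add_const [Nonempty X] (hc : IsBoundedFun c) (hf : IsBoundedFun f)
    (lam a : ℝ) (x : X) :
    laxOleinik c (fun y => lam * (f y + a)) x = laxOleinik c (fun y => lam * f y) x + lam * a := by
  apply le_antisymm
  · rw [← sub_le_iff_le_add]
    refine le_laxOleinik fun y => ?_
    have := laxOleinik_le hc ((hf.add_const a).const_mul lam) x y
    linarith
  · refine le_laxOleinik fun y => ?_
    have := laxOleinik_le hc (hf.const_mul lam) x y
    linarith

/-- Only `lam * a` passes through the operator, so `(1 - lam) * a` is left for the constant. -/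
lemma IsSolution.add_const [Nonempty X] (hc : IsBoundedFun c) (hu : IsSolution c lam C u) (a : ℝ) :
    IsSolution c lam (C + (1 - lam) * a) (fun x => u x + a) := by
  refine ⟨hu.1.add_const a, fun x => ?_⟩
  rw [laxOleinik_mul_add_const hc hu.1]
  linarith [hu.2 x]

lemma bddAbove_range_sub (hu : IsBoundedFun u) (hw : IsBoundedFun w) :
    BddAbove (range fun x => u x - w x) := by
  obtain ⟨K, hK⟩ := hu
  obtain ⟨L, hL⟩ := hw
  refine ⟨K + L, ?_⟩
  rintro _ ⟨z, rfl⟩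
  have := abs_le.1 (hK z)
  have := abs_le.1 (hL z)
  dsimp only
  linarith

/-- Common source of the comparison principle (`lam < 1`, `C = C'`) and of the uniqueness of the
critical value (`lam = 1`). -/
lemma iSup_sub_le [Nonempty X] (hc : IsBoundedFun c) (hlam : 0 ≤ lam) (hu : IsBoundedFun u)
    (hw : IsBoundedFun w) (hsub : ∀ x, u x ≤ laxOleinik c (fun y => lam * u y) x + C)
    (hsup : ∀ x, laxOleinik c (fun y => lam * w y) x + C' ≤ w x) :
    (⨆ x, (u x - w x)) ≤ lam * (⨆ x, (u x - w x)) + (C - C') := by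
  refine ciSup_le fun x => ?_
  set m := ⨆ x, (u x - w x)
  have h : laxOleinik c (fun y => lam * u y) x - lam * m ≤ laxOleinik c (fun y => lam * w y) x := by
    refine le_laxOleinik fun y => ?_
    have h1 := laxOleinik_le hc (hu.const_mul lam) x y
    have h2 : u y - w y ≤ m := le_ciSup (bddAbove_range_sub hu hw) y
    have h3 := mul_le_mul_of_nonneg_left h2 hlam
    linarith
  linarith [hsub x, hsup x]

/-- Comparison principle for the discounted equation. -/
lemma le_of_subsolution_of_supersolution [Nonempty X] (hc : IsBoundedFun c)
    (hlam : lam ∈ Ioo (0 : ℝ) 1) (hu : IsBoundedFun u) (hw : IsBoundedFun w)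
    (hsub : ∀ x, u x ≤ laxOleinik c (fun y => lam * u y) x + C)
    (hsup : ∀ x, laxOleinik c (fun y => lam * w y) x + C ≤ w x) (x : X) : u x ≤ w x := by
  have h := iSup_sub_le hc hlam.1.le hu hw hsub hsup
  have h2 : u x - w x ≤ ⨆ x, (u x - w x) := le_ciSup (bddAbove_range_sub hu hw) x
  nlinarith [hlam.2]

lemma IsSolution.unique [Nonempty X] (hc : IsBoundedFun c) (hlam : lam ∈ Ioo (0 : ℝ) 1)
    (hu : IsSolution c lam C u) (hw : IsSolution c lam C w) : u = w :=
  funext fun x => le_antisymm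
    (le_of_subsolution_of_supersolution hc hlam hu.1 hw.1 (fun x => (hu.2 x).le)
      (fun x => (hw.2 x).ge) x)
    (le_of_subsolution_of_supersolution hc hlam hw.1 hu.1 (fun x => (hw.2 x).le)
      (fun x => (hu.2 x).ge) x)

lemma IsSolution.le_critical [Nonempty X] (hc : IsBoundedFun c) (hu : IsSolution c 1 C u)
    (hw : IsSolution c 1 C' w) : C' ≤ C := by
  have := iSup_sub_le hc zero_le_one hu.1 hw.1 (fun x => (hu.2 x).le) (fun x => (hw.2 x).ge)
  linarith

lemma IsSolution.le (hc : IsBoundedFun c) (hu : IsSolution c lam C u) (x y : X) :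
    u x ≤ lam * u y + c (y, x) + C := by
  rw [hu.2 x]
  linarith [laxOleinik_le hc (hu.1.const_mul lam) x y]

lemma IsSolution.isSubsolution (hc : IsBoundedFun c) (hu : IsSolution c 1 C u) :
    IsSubsolution c C u := fun x y => by linarith [hu.le hc y x]

/-- Solutions of the discounted equation with critical constant are bounded uniformly in the
discount factor. -/
lemma IsSolution.abs_le_two_mul [Nonempty X] (hc : IsBoundedFun c) (hlam : lam ∈ Ioo (0 : ℝ) 1)
    (hu : IsSolution c 1 C u) {K : ℝ} (hK : ∀ x, |u x| ≤ K) (hw : IsSolution c lam C w) (x : X) :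
    |w x| ≤ 2 * K := by
  have hl : ∀ x, laxOleinik c u x + C = u x := fun x => by simpa using (hu.2 x).symm
  -- Since `u + K ≥ 0`, multiplying it by `lam` lowers it, so it is a discounted supersolution;
  -- dually, `u - K ≤ 0` is a subsolution.
  have h1 : w x ≤ u x + K := by
    refine le_of_subsolution_of_supersolution hc hlam hw.1 (hu.1.add_const K)
      (fun x => (hw.2 x).le) (fun x => ?_) x
    suffices laxOleinik c (fun y => lam * (u y + K)) x - K ≤ laxOleinik c u x by
      linarith [hl x]
    refine le_laxOleinik fun y => ?_
    have := laxOleinik_le hc ((hu.1.add_const K).const_mul lam) x y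
    have h2 := abs_le.1 (hK y)
    nlinarith [hlam.1, hlam.2]
  have h2 : u x + -K ≤ w x := by
    refine le_of_subsolution_of_supersolution hc hlam (hu.1.add_const (-K)) hw.1
      (fun x => ?_) (fun x => (hw.2 x).ge) x
    suffices laxOleinik c u x - K ≤ laxOleinik c (fun y => lam * (u y + -K)) x by
      linarith [hl x]
    refine le_laxOleinik fun y => ?_
    have := laxOleinik_le hc hu.1 x y
    have h2 := abs_le.1 (hK y)
    nlinarith [hlam.1, hlam.2]
  have h3 := abs_le.1 (hK x)
  exact abs_le.2 ⟨by linarith, by linarith⟩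

/-- The modulus comes from `c` alone, not from `f`; hence the equicontinuity of families of
solutions. -/
lemma abs_laxOleinik_sub_le [Nonempty X] (hc : IsBoundedFun c) (hf : IsBoundedFun f) {ε : ℝ}
    {x x' : X} (h : ∀ y, |c (y, x) - c (y, x')| < ε) : |laxOleinik c f x - laxOleinik c f x'| ≤ ε := by
  rw [abs_sub_le_iff]
  constructor
  · rw [sub_le_comm]
    refine le_laxOleinik fun y => ?_
    have := laxOleinik_le hc hf x y
    linarith [abs_lt.1 (h y)]
  · rw [sub_le_comm]
    refine le_laxOleinik fun y => ?_
    have := laxOleinik_le hc hf x' y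
    linarith [abs_lt.1 (h y)]

end Operator

/-! ### Compactness, stability and existence of solutions -/

section Compact

variable {X : Type*} [MetricSpace X] [CompactSpace X] {c : X × X → ℝ} {f u : X → ℝ} {lam C : ℝ}

lemma exists_modulus (hc : Continuous c) {ε : ℝ} (hε : 0 < ε) :
    ∃ δ > 0, ∀ x x', dist x x' < δ →
      ∀ y, |c (x, y) - c (x', y)| < ε ∧ |c (y, x) - c (y, x')| < ε := by
  obtain ⟨δ, hδ, h⟩ :=
    Metric.uniformContinuous_iff.1 (CompactSpace.uniformContinuous_of_continuous hc) ε hε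
  refine ⟨δ, hδ, fun x x' hx y => ⟨?_, ?_⟩⟩
  · have := @h (x, y) (x', y) (by rw [Prod.dist_eq, dist_self]; exact max_lt hx hδ)
    rwa [Real.dist_eq] at this
  · have := @h (y, x) (y, x') (by rw [Prod.dist_eq, dist_self]; exact max_lt hδ hx)
    rwa [Real.dist_eq] at this

variable [Nonempty X]

lemma continuous_laxOleinik (hc : Continuous c) (hf : IsBoundedFun f) :
    Continuous (laxOleinik c f) := by
  rw [Metric.continuous_iff]
  intro x ε hε
  obtain ⟨δ, hδ, h⟩ := exists_modulus hc (half_pos hε)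
  refine ⟨δ, hδ, fun y hy => ?_⟩
  have := abs_laxOleinik_sub_le (.of_continuous hc) hf fun z => (h y x hy z).2
  rw [Real.dist_eq]
  linarith

lemma IsSolution.continuous (hc : Continuous c) (hu : IsSolution c lam C u) : Continuous u := by
  rw [funext hu.2]
  exact (continuous_laxOleinik hc (hu.1.const_mul lam)).add continuous_const

lemma IsSolution.exists_calibrated (hc : Continuous c) (hu : IsSolution c lam C u) (x : X) :
    ∃ y, u x = lam * u y + c (y, x) + C := by
  have hcont : Continuous fun y => lam * u y + c (y, x) :=
    (continuous_const.mul (hu.continuous hc)).add (hc.comp (by fun_prop))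
  obtain ⟨y, -, hy⟩ := isCompact_univ.exists_isMinOn univ_nonempty hcont.continuousOn
  refine ⟨y, le_antisymm (hu.le (.of_continuous hc) x y) ?_⟩
  rw [hu.2 x]
  gcongr
  exact le_laxOleinik fun z => hy (mem_univ z)

lemma equicontinuous_of_isSolution (hc : Continuous c) {ι : Type*} {lam C : ι → ℝ}
    {v : ι → X → ℝ} (hv : ∀ i, IsSolution c (lam i) (C i) (v i)) : Equicontinuous v := by
  apply UniformEquicontinuous.equicontinuous
  rw [Metric.uniformEquicontinuous_iff]
  intro ε hε
  obtain ⟨δ, hδ, h⟩ := exists_modulus hc (half_pos hε)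
  refine ⟨δ, hδ, fun x y hxy i => ?_⟩
  have := abs_laxOleinik_sub_le (.of_continuous hc) ((hv i).1.const_mul (lam i))
    fun z => (h x y hxy z).2
  rw [Real.dist_eq, (hv i).2 x, (hv i).2 y, add_sub_add_right_eq_sub]
  linarith

lemma tendstoUniformly_of_isSolution (hc : Continuous c) {ι : Type*} {lam C : ι → ℝ}
    {v : ι → X → ℝ} (hv : ∀ i, IsSolution c (lam i) (C i) (v i)) {l : Filter ι}
    (hu : ∀ x, Tendsto (fun i => v i x) l (𝓝 (u x))) : TendstoUniformly v u l := by
  have := (equicontinuous_of_isSolution hc hv).tendsto_uniformFun_iff_pi l u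
  rw [UniformFun.tendsto_iff_tendstoUniformly] at this
  exact this.2 (tendsto_pi_nhds.2 hu)

/-- Stability of the equation under pointwise limits. -/
lemma isSolution_of_tendsto (hc : Continuous c) {ι : Type*} {lam C : ι → ℝ} {lam₀ C₀ : ℝ}
    {v : ι → X → ℝ} (hv : ∀ i, IsSolution c (lam i) (C i) (v i)) {l : Ultrafilter ι}
    (hlam : Tendsto lam l (𝓝 lam₀)) (hC : Tendsto C l (𝓝 C₀))
    (hu : ∀ x, Tendsto (fun i => v i x) l (𝓝 (u x))) : IsSolution c lam₀ C₀ u := by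
  have hunif := tendstoUniformly_of_isSolution hc hv hu
  have hcu : Continuous u :=
    hunif.continuous (Eventually.frequently (Eventually.of_forall fun i => (hv i).continuous hc))
  refine ⟨.of_continuous hcu, fun x => le_antisymm ?_ ?_⟩
  · rw [← sub_le_iff_le_add]
    refine le_laxOleinik fun y => ?_
    rw [sub_le_iff_le_add]
    refine le_of_tendsto_of_tendsto' (hu x) (((hlam.mul (hu y)).add_const (c (y, x))).add hC)
      fun i => (hv i).le (.of_continuous hc) x y
  -- The minimizers converge along `l`, and uniform convergence allows evaluation at these moving
  -- points.
  · choose y hy using fun i => (hv i).exists_calibrated hc x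
    obtain ⟨z, -, hz⟩ := isCompact_univ.ultrafilter_le_nhds (l.map y) (by simp)
    have hyz : Tendsto y l (𝓝 z) := hz
    have h1 : Tendsto (fun i => v i (y i)) l (𝓝 (u z)) := by
      have := hunif.tendstoLocallyUniformly.tendsto_comp (g := y) hcu.continuousAt hyz
      exact this
    have h2 : Tendsto (fun i => c (y i, x)) l (𝓝 (c (z, x))) :=
      ((hc.comp (f := fun y => (y, x)) (by fun_prop)).tendsto z).comp hyz
    have h3 : u x = lam₀ * u z + c (z, x) + C₀ :=
      tendsto_nhds_unique (hu x) ((((hlam.mul h1).add h2).add hC).congr fun i => (hy i).symm)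
    rw [h3]
    gcongr
    exact laxOleinik_le (.of_continuous hc) ((IsBoundedFun.of_continuous hcu).const_mul _) x z

/-- The discounted equation is solved by a contraction argument. -/
lemma exists_isDiscountedSolution (hc : Continuous c) (hlam : lam ∈ Ioo (0 : ℝ) 1) :
    ∃ u, IsDiscountedSolution c lam u := by
  let T : C(X, ℝ) → C(X, ℝ) := fun f => ⟨laxOleinik c (fun y => lam * f y),
    continuous_laxOleinik hc ((IsBoundedFun.of_continuous f.continuous).const_mul lam)⟩
  have hT : ContractingWith ⟨lam, hlam.1.le⟩ T := by
    refine ⟨by exact_mod_cast hlam.2, LipschitzWith.of_dist_le_mul fun f g => ?_⟩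
    have key : ∀ f g : C(X, ℝ), ∀ x, T f x ≤ T g x + lam * dist f g := by
      intro f g x
      rw [← sub_le_iff_le_add]
      refine le_laxOleinik fun y => ?_
      have h1 := laxOleinik_le (.of_continuous hc)
        ((IsBoundedFun.of_continuous f.continuous).const_mul lam) x y
      have h2 : f y - g y ≤ dist f g := by
        have := ContinuousMap.dist_apply_le_dist (f := f) (g := g) y
        rw [Real.dist_eq] at this
        exact (le_abs_self _).trans this
      have h3 := mul_le_mul_of_nonneg_left h2 hlam.1.le
      have h4 : T f x = laxOleinik c (fun y => lam * f y) x := rfl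
      rw [h4]
      linarith
    refine (ContinuousMap.dist_le (mul_nonneg hlam.1.le dist_nonneg)).2 fun x => ?_
    have h1 := key f g x
    have h2 := key g f x
    rw [dist_comm g f] at h2
    rw [Real.dist_eq, abs_sub_le_iff]
    exact ⟨sub_le_iff_le_add'.2 h1, sub_le_iff_le_add'.2 h2⟩
  let f := hT.fixedPoint T
  refine ⟨f, .of_continuous f.continuous, ?_⟩
  have : T f = f := hT.fixedPoint_isFixedPt
  exact (congrArg DFunLike.coe this).symm

lemma IsDiscountedSolution.isSolution_add (hc : Continuous c) {lam : ℝ}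
    (hlam : lam ∈ Ioo (0 : ℝ) 1) (hu : IsDiscountedSolution c lam u) (C : ℝ) :
    IsSolution c lam C fun x => u x + C / (1 - lam) := by
  have h := (isSolution_zero_iff.2 hu).add_const (.of_continuous hc) (C / (1 - lam))
  rwa [zero_add, mul_div_cancel₀ _ (sub_pos.2 hlam.2).ne'] at h

/-- A critical value exists: it is a limit of `-(1 - lam) u_lam`. -/
lemma exists_isCriticalValue (hc : Continuous c) : ∃ C, IsCriticalValue c C := by
  have hcb := IsBoundedFun.of_continuous hc
  choose u hu using fun lam : Ioo (0 : ℝ) 1 => exists_isDiscountedSolution hc lam.2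
  have ⟨K, hK⟩ := hcb
  obtain ⟨x₀⟩ := ‹Nonempty X›
  have : Nonempty X := ⟨x₀⟩
  have hu' := fun lam => isSolution_zero_iff.2 (hu lam)
  have hosc : ∀ lam x x', |u lam x - u lam x'| ≤ 2 * K + 1 := by
    intro lam x x'
    rw [(hu' lam).2 x, (hu' lam).2 x', add_sub_add_right_eq_sub]
    refine abs_laxOleinik_sub_le hcb ((hu' lam).1.const_mul _) fun y => ?_
    have h1 := abs_le.1 (hK (y, x))
    have h2 := abs_le.1 (hK (y, x'))
    exact abs_lt.2 ⟨by linarith, by linarith⟩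
  -- The expression is the constant that `IsSolution.add_const` yields for the shift `-u lam x₀`.
  -- For a calibrating `y`, `(1 - lam) * u x₀ = lam * (u y - u x₀) + c (y, x₀)`, which the
  -- oscillation bound controls.
  have hmul : ∀ lam : Ioo (0 : ℝ) 1, |0 + (1 - (lam : ℝ)) * -u lam x₀| ≤ 3 * K + 1 := by
    intro lam
    obtain ⟨y, hy⟩ := (hu' lam).exists_calibrated hc x₀
    have h1 := (hu' lam).le hcb x₀ x₀
    have h2 := abs_le.1 (hosc lam x₀ y)
    have h3 := abs_le.1 (hK (x₀, x₀))
    have h4 := abs_le.1 (hK (y, x₀))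
    have h5 := lam.2
    exact abs_le.2 ⟨by linarith, by nlinarith [h5.1, h5.2]⟩
  let l : Ultrafilter (Ioo (0 : ℝ) 1) := Ultrafilter.of (comap (↑) (𝓝[<] (1 : ℝ)))
  have hl : Tendsto ((↑) : Ioo (0 : ℝ) 1 → ℝ) l (𝓝 1) :=
    (tendsto_comap.mono_left (Ultrafilter.of_le _)).mono_right nhdsWithin_le_nhds
  obtain ⟨C, hC⟩ := exists_tendsto_of_abs_le l hmul
  choose w hw using fun x => exists_tendsto_of_abs_le l (g := fun lam => u lam x + -u lam x₀)
    (fun lam => by simpa [← sub_eq_add_neg] using hosc lam x x₀)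
  exact ⟨C, w, isSolution_one_iff.1 (isSolution_of_tendsto hc
    (fun lam => (hu' lam).add_const hcb (-u lam x₀)) hl hC hw)⟩

end Compact

/-! ### Mather measures and discounted occupation measures -/

section Measures

lemma integrable_of_continuous {Y : Type*} [TopologicalSpace Y] [CompactSpace Y]
    [MeasurableSpace Y] [OpensMeasurableSpace Y] [SecondCountableTopology Y]
    {μ : Measure Y} [IsFiniteMeasure μ] {f : Y → ℝ} (hf : Continuous f) : Integrable f μ := by
  obtain ⟨K, hK⟩ := IsBoundedFun.of_continuous hf
  exact Integrable.of_bound hf.aestronglyMeasurable K (ae_of_all _ hK)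

lemma integral_map_fst {X : Type*} [TopologicalSpace X] [MeasurableSpace X] [BorelSpace X]
    {μ : Measure (X × X)} {w : X → ℝ} (hw : Continuous w) :
    ∫ y, w y ∂(μ.map Prod.fst) = ∫ p, w p.1 ∂μ :=
  integral_map measurable_fst.aemeasurable hw.measurable.aestronglyMeasurable

lemma IsMatherMeasure.integral_fst_eq {X : Type*} [TopologicalSpace X] [MeasurableSpace X]
    [BorelSpace X] {c : X × X → ℝ} {C : ℝ} {μ : Measure (X × X)} (hμ : IsMatherMeasure c C μ)
    {w : X → ℝ} (hw : Continuous w) : ∫ p, w p.1 ∂μ = ∫ p, w p.2 ∂μ := by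
  rw [← integral_map_fst hw, hμ.closed,
    integral_map measurable_snd.aemeasurable hw.measurable.aestronglyMeasurable]

lemma hasSum_geometric_telescope {lam : ℝ} (hlam : lam ∈ Ioo (0 : ℝ) 1) {b : ℕ → ℝ} {K : ℝ}
    (hb : ∀ k, |b k| ≤ K) : HasSum (fun k => lam ^ k * (b k - lam * b (k + 1))) (b 0) := by
  have hs : Summable fun k => lam ^ k * b k := by
    refine Summable.of_norm_bounded ((summable_geometric_of_lt_one hlam.1.le hlam.2).mul_right K)
      fun k => ?_
    rw [norm_mul, Real.norm_of_nonneg (pow_nonneg hlam.1.le k)]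
    exact mul_le_mul_of_nonneg_left (hb k) (pow_nonneg hlam.1.le k)
  have h1 := hs.hasSum
  have h2 := (hasSum_nat_add_iff' 1).2 h1
  convert! h1.sub h2 using 1
  · ext k
    ring
  · simp

variable {X : Type*} [MetricSpace X] [CompactSpace X] [MeasurableSpace X] [BorelSpace X]
  {c : X × X → ℝ}

/-- The discounted occupation measure of a backward orbit `x 0, x 1, …`. -/
lemma exists_discounted_measure {lam : ℝ} (hlam : lam ∈ Ioo (0 : ℝ) 1) (x : ℕ → X) :
    ∃ μ : ProbabilityMeasure (X × X),
      (∀ w : X → ℝ, Continuous w →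
        ∫ p, (w p.2 - lam * w p.1) ∂(μ : Measure (X × X)) = (1 - lam) * w (x 0)) ∧
      ∀ P : X × X → Prop, (∀ k, P (x (k + 1), x k)) → ∀ᵐ p ∂(μ : Measure (X × X)), P p := by
  set a : ℕ → ENNReal := fun k => ENNReal.ofReal ((1 - lam) * lam ^ k) with ha
  have hnn : ∀ k : ℕ, 0 ≤ (1 - lam) * lam ^ k := fun k =>
    mul_nonneg (sub_nonneg.2 hlam.2.le) (pow_nonneg hlam.1.le k)
  have hgs := (hasSum_geometric_of_lt_one hlam.1.le hlam.2).mul_left (1 - lam)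
  rw [mul_inv_cancel₀ (sub_pos.2 hlam.2).ne'] at hgs
  set μ : Measure (X × X) := Measure.sum fun k => a k • Measure.dirac (x (k + 1), x k) with hμ
  have hprob : IsProbabilityMeasure μ := by
    constructor
    rw [hμ, Measure.sum_apply _ MeasurableSet.univ]
    simp only [Measure.smul_apply, measure_univ, smul_eq_mul, mul_one, ha]
    rw [← ENNReal.ofReal_tsum_of_nonneg hnn hgs.summable, hgs.tsum_eq, ENNReal.ofReal_one]
  refine ⟨⟨μ, hprob⟩, fun w hw => ?_, fun P hP => ?_⟩
  · obtain ⟨K, hK⟩ := IsBoundedFun.of_continuous hw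
    have hcont : Continuous fun p : X × X => w p.2 - lam * w p.1 := by fun_prop
    have h1 := hasSum_integral_measure (μ := fun k => a k • Measure.dirac (x (k + 1), x k))
      (integrable_of_continuous (μ := μ) hcont)
    refine h1.unique ?_
    convert! (hasSum_geometric_telescope hlam (b := fun k => w (x k)) fun k => hK _).mul_left
      (1 - lam) using 1
    ext k
    rw [integral_smul_measure, integral_dirac, ha, ENNReal.toReal_ofReal (hnn k), smul_eq_mul]
    ring
  · simp only [ProbabilityMeasure.coe_mk, hμ]
    rw [Measure.ae_sum_iff]
    intro k
    refine Measure.ae_smul_measure ?_ _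
    rw [ae_dirac_eq]
    exact hP k

variable [Nonempty X]

/-- Integrals of discounted solutions against Mather measures are nonpositive. -/
lemma IsMatherMeasure.integral_nonpos (hc : Continuous c) {C lam : ℝ} (hlam : lam ∈ Ioo (0 : ℝ) 1)
    {v : X → ℝ} (hv : IsSolution c lam C v) {μ : Measure (X × X)} (hμ : IsMatherMeasure c C μ) :
    ∫ p, v p.1 ∂μ ≤ 0 := by
  have := hμ.isProbabilityMeasure
  have hvc := hv.continuous hc
  have h1 : Integrable (fun p : X × X => v p.1) μ :=
    integrable_of_continuous (by fun_prop)
  have h2 : Integrable c μ := integrable_of_continuous hc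
  -- Closedness makes the left side `(1 - lam) ∫ v`; minimality makes the right side zero.
  have h3 : ∫ p, (v p.2 - lam * v p.1) ∂μ ≤ ∫ p, (c p + C) ∂μ :=
    integral_mono (integrable_of_continuous (by fun_prop))
      (integrable_of_continuous (by fun_prop)) fun p => by
        have := hv.le (.of_continuous hc) p.2 p.1
        dsimp only
        linarith
  rw [integral_sub (integrable_of_continuous (by fun_prop)) (h1.const_mul lam),
    integral_add h2 (integrable_const _), integral_const_mul, hμ.minimizing,
    ← hμ.integral_fst_eq hvc] at h3
  simp only [integral_const, probReal_univ, one_smul] at h3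
  nlinarith [hlam.2]

/-- A limit of discounted occupation measures is a Mather measure bounding continuous
subsolutions from above by the limit of the discounted solutions. -/
lemma exists_isMatherMeasure_le (hc : Continuous c) {ι : Type*} {lam : ι → ℝ} {C : ℝ}
    (hlam : ∀ i, lam i ∈ Ioo (0 : ℝ) 1) {v : ι → X → ℝ}
    (hv : ∀ i, IsSolution c (lam i) C (v i)) {l : Ultrafilter ι} (hl : Tendsto lam l (𝓝 1))
    {x : X} {t : ℝ} (ht : Tendsto (fun i => v i x) l (𝓝 t)) :
    ∃ μ, IsMatherMeasure c C μ ∧ ∀ w, Continuous w → IsSubsolution c C w →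
      w x - ∫ y, w y ∂(μ.map Prod.fst) ≤ t := by
  choose g hg using fun i x => (hv i).exists_calibrated hc x
  choose m hm hae using fun i => exists_discounted_measure (hlam i) fun k => (g i)^[k] x
  simp only [Function.iterate_zero, id_eq] at hm
  obtain ⟨μ, -, hμ⟩ := isCompact_univ.ultrafilter_le_nhds (l.map m) (by simp)
  have hlim : ∀ f : X × X → ℝ, Continuous f → Tendsto (fun i => ∫ p, f p ∂(m i : Measure (X × X))) l
      (𝓝 (∫ p, f p ∂(μ : Measure (X × X)))) := fun f hf =>
    ((ProbabilityMeasure.continuous_integral_continuousMap (⟨f, hf⟩ : C(X × X, ℝ))).tendsto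
      μ).comp hμ
  have hint : ∀ {ν : ProbabilityMeasure (X × X)} {f : X × X → ℝ}, Continuous f →
      Integrable f (ν : Measure (X × X)) := fun hf => integrable_of_continuous hf
  have hsnd : ∀ w : X → ℝ, Continuous w → ∫ y, w y ∂((μ : Measure (X × X)).map Prod.snd) =
      ∫ p, w p.2 ∂(μ : Measure (X × X)) := fun w hw =>
    integral_map measurable_snd.aemeasurable hw.aestronglyMeasurable
  have hone : Tendsto (fun i => 1 - lam i) l (𝓝 0) := by simpa using hl.const_sub 1
  -- Calibration is an equality along the orbit, which carries `m i`.
  have hcost : ∀ i, ∫ p, c p ∂(m i : Measure (X × X)) = (1 - lam i) * v i x - C := by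
    intro i
    have h1 : c =ᵐ[(m i : Measure (X × X))] fun p => (v i p.2 - lam i * v i p.1) - C := by
      refine hae i _ fun k => ?_
      have := hg i ((g i)^[k] x)
      rw [← Function.iterate_succ_apply' (g i)] at this
      dsimp only
      linarith
    have := (hv i).continuous hc
    rw [integral_congr_ae h1, integral_sub (hint (by fun_prop)) (integrable_const _),
      hm i _ this]
    simp
  refine ⟨μ, ⟨inferInstance, ?_, ?_⟩, fun w hw hsub => ?_⟩
  · have : IsProbabilityMeasure ((μ : Measure (X × X)).map Prod.fst) :=
      Measure.isProbabilityMeasure_map measurable_fst.aemeasurable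
    have : IsProbabilityMeasure ((μ : Measure (X × X)).map Prod.snd) :=
      Measure.isProbabilityMeasure_map measurable_snd.aemeasurable
    refine ext_of_forall_integral_eq_of_IsFiniteMeasure fun w => ?_
    have hw := w.continuous
    rw [integral_map_fst hw, hsnd w hw]
    -- The same limit computed twice: the closedness defect `(1 - lam i) * w x` vanishes.
    have h1 : Tendsto (fun i => ∫ p, (w p.2 - lam i * w p.1) ∂(m i : Measure (X × X))) l
        (𝓝 (0 * w x)) := (hone.mul_const (w x)).congr fun i => (hm i w hw).symm
    have h2 : Tendsto (fun i => ∫ p, (w p.2 - lam i * w p.1) ∂(m i : Measure (X × X))) l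
        (𝓝 (∫ p, w p.2 ∂(μ : Measure (X × X)) - 1 * ∫ p, w p.1 ∂(μ : Measure (X × X)))) := by
      refine ((hlim (fun p => w p.2) (by fun_prop)).sub
        (hl.mul (hlim (fun p => w p.1) (by fun_prop)))).congr fun i => ?_
      rw [integral_sub (hint (by fun_prop)) (hint (by fun_prop)), integral_const_mul]
    have := tendsto_nhds_unique h1 h2
    linarith
  · have h1 := (hone.mul ht).sub_const C
    have := tendsto_nhds_unique (hlim c hc) (h1.congr fun i => (hcost i).symm)
    rw [this]
    ring
  · rw [integral_map_fst hw]
    refine le_of_tendsto_of_tendsto' ((hlim (fun p => w p.1) (by fun_prop)).const_sub (w x)) ht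
      fun i => ?_
    -- The integrand is `w p.2 - w p.1`. Every term left after integration carries the factor `1 -
    -- lam i`, which is divided out before the limit.
    have h1 : ∫ p, ((w p.2 - lam i * w p.1) - (1 - lam i) * w p.1) ∂(m i : Measure (X × X)) ≤
        ∫ p, (c p + C) ∂(m i : Measure (X × X)) :=
      integral_mono (hint (by fun_prop)) (hint (by fun_prop)) fun p => by
        have := hsub p.1 p.2
        dsimp only
        linarith
    rw [integral_sub (hint (by fun_prop)) (hint (by fun_prop)), hm i w hw, integral_const_mul,
      integral_add (hint hc) (integrable_const _), hcost i] at h1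
    simp only [integral_const, probReal_univ, one_smul] at h1
    nlinarith [(hlam i).2]

end Measures

/-! ### Costs of finite chains -/

section Chains

variable {X : Type*} {c : X × X → ℝ} {C : ℝ} {w : X → ℝ} {n m : ℕ} {x y : X}

lemma chainCost_le (hc : IsBoundedFun c) (z : ℕ → X) (n : ℕ) :
    chainCost c n (z 0) (z n) ≤ ∑ i ∈ Finset.range n, c (z i, z (i + 1)) := by
  obtain ⟨K, hK⟩ := hc
  refine csInf_le ⟨∑ i ∈ Finset.range n, -K, ?_⟩ ⟨z, rfl, rfl, rfl⟩
  rintro _ ⟨z', -, -, rfl⟩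
  exact Finset.sum_le_sum fun i _ => (abs_le.1 (hK _)).1

/-- For `n = 0` and `x ≠ y` there is no chain and `sInf` takes its default value; the liminf does
not see this. -/
lemma nonempty_chains (hn : 1 ≤ n) (c : X × X → ℝ) (x y : X) :
    {s : ℝ | ∃ z : ℕ → X, z 0 = x ∧ z n = y ∧
      s = ∑ i ∈ Finset.range n, c (z i, z (i + 1))}.Nonempty :=
  ⟨_, fun i => if i = 0 then x else y, if_pos rfl, if_neg (by omega), rfl⟩

lemma le_chainCost (hn : 1 ≤ n) {a : ℝ} (h : ∀ z : ℕ → X, z 0 = x → z n = y →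
    a ≤ ∑ i ∈ Finset.range n, c (z i, z (i + 1))) : a ≤ chainCost c n x y := by
  refine le_csInf (nonempty_chains hn c x y) ?_
  rintro _ ⟨z, h0, h1, rfl⟩
  exact h z h0 h1

lemma chainCost_one_le (hc : IsBoundedFun c) (x y : X) : chainCost c 1 x y ≤ c (x, y) := by
  simpa using chainCost_le hc (fun i => if i = 0 then x else y) 1

lemma chainCost_add_le (hc : IsBoundedFun c) (hn : 1 ≤ n) (hm : 1 ≤ m) (x y t : X) :
    chainCost c (n + m) x t ≤ chainCost c n x y + chainCost c m y t := by
  rw [← sub_le_iff_le_add]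
  refine le_chainCost hn fun z h0 hn' => ?_
  rw [sub_le_comm]
  refine le_chainCost hm fun z' h0' hm' => ?_
  rw [sub_le_iff_le_add']
  set q : ℕ → X := fun i => if i ≤ n then z i else z' (i - n) with hq
  have hq' : ∀ i, q (n + i) = z' i := by
    intro i
    rcases Nat.eq_zero_or_pos i with rfl | hi
    · simp [hq, hn', h0']
    · simp [hq, hi.ne']
  have h := chainCost_le hc q (n + m)
  have h1 : q 0 = x := by simp [hq, h0]
  rw [h1, hq', hm', Finset.sum_range_add] at h
  refine h.trans_eq (congrArg₂ _ (Finset.sum_congr rfl fun i hi => ?_)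
    (Finset.sum_congr rfl fun i _ => ?_))
  · have := Finset.mem_range.1 hi
    simp only [hq]
    rw [if_pos (by omega), if_pos (by omega)]
  · rw [add_assoc, hq', hq']

/-- Moving an endpoint changes a single term, so the error does not grow with `n`. -/
lemma chainCost_le_add_left (hc : IsBoundedFun c) (hn : 1 ≤ n) {x x' : X} {ε : ℝ}
    (h : ∀ y, |c (x, y) - c (x', y)| < ε) (y : X) :
    chainCost c n x y ≤ chainCost c n x' y + ε := by
  rw [← sub_le_iff_le_add]
  refine le_chainCost hn fun z h0 hn' => ?_
  rw [sub_le_iff_le_add]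
  obtain ⟨n, rfl⟩ := Nat.exists_eq_add_of_le' hn
  have h1 := chainCost_le hc (fun i => if i = 0 then x else z i) (n + 1)
  have h2 := (abs_lt.1 (h (z 1))).2
  rw [Finset.sum_range_succ'] at h1 ⊢
  simp only [Nat.add_eq_zero_iff, one_ne_zero, and_false, if_false, if_true, hn', zero_add] at h1
  simp only [zero_add, h0]
  linarith

lemma chainCost_le_add_right (hc : IsBoundedFun c) (hn : 1 ≤ n) {y y' : X} {ε : ℝ}
    (h : ∀ x, |c (x, y) - c (x, y')| < ε) (x : X) :
    chainCost c n x y ≤ chainCost c n x y' + ε := by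
  rw [← sub_le_iff_le_add]
  refine le_chainCost hn fun z h0 hn' => ?_
  rw [sub_le_iff_le_add]
  obtain ⟨n, rfl⟩ := Nat.exists_eq_add_of_le' hn
  have h1 := chainCost_le hc (fun i => if i ≤ n then z i else y) (n + 1)
  have h2 := (abs_lt.1 (h (z n))).2
  rw [Finset.sum_range_succ, Finset.sum_congr rfl (g := fun i => c (z i, z (i + 1)))] at h1
  · rw [Finset.sum_range_succ, hn']
    simp only [Nat.zero_le, if_true, h0, le_refl, Nat.not_succ_le_self, if_false] at h1
    linarith
  · intro i hi
    have := Finset.mem_range.1 hi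
    rw [if_pos (by omega), if_pos (by omega)]

lemma IsSubsolution.sub_le_chainCost (hw : IsSubsolution c C w) (hn : 1 ≤ n) (x y : X) :
    w y - w x ≤ chainCost c n x y + n * C := by
  rw [← sub_le_iff_le_add]
  refine le_chainCost hn fun z h0 hn' => ?_
  rw [sub_le_iff_le_add, ← h0, ← hn', ← Finset.sum_range_sub (fun i => w (z i))]
  refine (Finset.sum_le_sum fun i _ => hw (z i) (z (i + 1))).trans_eq ?_
  simp [Finset.sum_add_distrib]

/-- The cost of a calibrated backward orbit. -/
lemma chainCost_iterate_le (hc : IsBoundedFun c) {u : X → ℝ} {g : X → X}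
    (hg : ∀ x, u x = u (g x) + c (g x, x) + C) (hn : 1 ≤ n) (x : X) :
    chainCost c n (g^[n] x) x + n * C ≤ u x - u (g^[n] x) := by
  induction n, hn using Nat.le_induction with
  | base =>
    have := chainCost_one_le hc (g x) x
    simp only [Function.iterate_one, Nat.cast_one]
    linarith [hg x]
  | succ n hn ih =>
    have h1 := chainCost_add_le hc le_rfl hn (g^[n + 1] x) (g^[n] x) x
    have h2 := chainCost_one_le hc (g^[n + 1] x) (g^[n] x)
    have h3 := hg (g^[n] x)
    rw [← Function.iterate_succ_apply' g] at h3
    rw [add_comm 1 n] at h1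
    push_cast
    linarith

lemma isBoundedUnder_ge_chainCost (hc : IsBoundedFun c) {u : X → ℝ}
    (hu : IsSolution c 1 C u) (x y : X) :
    IsBoundedUnder (· ≥ ·) atTop fun n : ℕ => chainCost c n x y + n * C :=
  isBoundedUnder_of_eventually_ge ((eventually_ge_atTop 1).mono fun _ hn =>
    (hu.isSubsolution hc).sub_le_chainCost hn x y)

lemma peierlsBarrier_le_of_frequently (hc : IsBoundedFun c) {u : X → ℝ}
    (hu : IsSolution c 1 C u) {a : ℝ}
    (h : ∃ᶠ n : ℕ in atTop, chainCost c n x y + n * C ≤ a) : peierlsBarrier c C x y ≤ a :=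
  liminf_le_of_frequently_le h (isBoundedUnder_ge_chainCost hc hu x y)

end Chains

/-! ### The Peierls barrier and the Aubry set -/

section Peierls

variable {X : Type*} [MetricSpace X] [CompactSpace X] [Nonempty X] {c : X × X → ℝ} {C : ℝ}
  {u w : X → ℝ}

/-- With `isBoundedUnder_ge_chainCost`, this keeps the real liminf from being a default value. A
calibrated orbit ending at `y` costs at most `2 * L`, and moving its start to `x` at most `2 * K +
1`. -/
lemma isBoundedUnder_le_chainCost (hc : Continuous c) (hu : IsSolution c 1 C u) (x y : X) :
    IsBoundedUnder (· ≤ ·) atTop fun n : ℕ => chainCost c n x y + n * C := by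
  choose g hg using fun x => hu.exists_calibrated hc x
  simp only [one_mul] at hg
  have hcb := IsBoundedFun.of_continuous hc
  have ⟨K, hK⟩ := hcb
  have ⟨L, hL⟩ := hu.1
  refine isBoundedUnder_of_eventually_le (a := 2 * L + (2 * K + 1))
    ((eventually_ge_atTop 1).mono fun n hn => ?_)
  have h1 := chainCost_iterate_le hcb hg hn y
  have h2 := chainCost_le_add_left hcb hn (x := x) (x' := g^[n] y) (ε := 2 * K + 1) (fun z => by
    have h1 := abs_le.1 (hK (x, z))
    have h2 := abs_le.1 (hK (g^[n] y, z))
    exact abs_lt.2 ⟨by linarith, by linarith⟩) y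
  have h3 := abs_le.1 (hL y)
  have h4 := abs_le.1 (hL (g^[n] y))
  linarith

lemma frequently_chainCost_lt (hc : Continuous c) (hu : IsSolution c 1 C u) {x y : X}
    {a : ℝ} (h : peierlsBarrier c C x y < a) :
    ∃ᶠ n : ℕ in atTop, chainCost c n x y + n * C < a :=
  frequently_lt_of_liminf_lt (isBoundedUnder_le_chainCost hc hu x y).isCoboundedUnder_ge h

lemma exists_chainCost_lt (hc : Continuous c) (hu : IsSolution c 1 C u) {x y : X}
    {a : ℝ} (h : peierlsBarrier c C x y < a) (N : ℕ) :
    ∃ n, N ≤ n ∧ 1 ≤ n ∧ chainCost c n x y + n * C < a := by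
  obtain ⟨n, hn, h⟩ := frequently_atTop.1 (frequently_chainCost_lt hc hu h) (max N 1)
  exact ⟨n, (le_max_left _ _).trans hn, (le_max_right _ _).trans hn, h⟩

lemma IsSubsolution.sub_le_peierlsBarrier (hc : Continuous c) (hu : IsSolution c 1 C u)
    (hw : IsSubsolution c C w) (x y : X) : w y - w x ≤ peierlsBarrier c C x y := by
  refine le_of_forall_gt fun a ha => ?_
  obtain ⟨n, -, hn, h⟩ := exists_chainCost_lt hc hu ha 0
  exact (hw.sub_le_chainCost hn x y).trans_lt h

lemma peierlsBarrier_triangle (hc : Continuous c) (hu : IsSolution c 1 C u) (x y z : X) :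
    peierlsBarrier c C x z ≤ peierlsBarrier c C x y + peierlsBarrier c C y z := by
  refine le_of_forall_pos_le_add fun ε hε => ?_
  have hcb := IsBoundedFun.of_continuous hc
  refine peierlsBarrier_le_of_frequently hcb hu (frequently_atTop.2 fun N => ?_)
  obtain ⟨n, hN, hn, h1⟩ := exists_chainCost_lt hc hu
    (lt_add_of_pos_right (peierlsBarrier c C x y) (half_pos hε)) N
  obtain ⟨m, -, hm, h2⟩ := exists_chainCost_lt hc hu
    (lt_add_of_pos_right (peierlsBarrier c C y z) (half_pos hε)) 0
  refine ⟨n + m, hN.trans (Nat.le_add_right n m), ?_⟩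
  have := chainCost_add_le hcb hn hm x y z
  push_cast
  linarith

lemma peierlsBarrier_le_cost_add (hc : Continuous c) (hu : IsSolution c 1 C u) (x y z : X) :
    peierlsBarrier c C x z ≤ c (x, y) + C + peierlsBarrier c C y z := by
  refine le_of_forall_pos_le_add fun ε hε => ?_
  have hcb := IsBoundedFun.of_continuous hc
  refine peierlsBarrier_le_of_frequently hcb hu (frequently_atTop.2 fun N => ?_)
  obtain ⟨m, hN, hm, h2⟩ := exists_chainCost_lt hc hu
    (lt_add_of_pos_right (peierlsBarrier c C y z) hε) N
  refine ⟨1 + m, hN.trans (Nat.le_add_left m 1), ?_⟩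
  have h1 := chainCost_add_le hcb le_rfl hm x y z
  have h3 := chainCost_one_le hcb x y
  push_cast
  linarith

lemma isSubsolution_neg_peierlsBarrier (hc : Continuous c) (hu : IsSolution c 1 C u) (x : X) :
    IsSubsolution c C fun y => -peierlsBarrier c C y x := fun y z => by
  linarith [peierlsBarrier_le_cost_add hc hu y z x]

lemma continuous_peierlsBarrier_left (hc : Continuous c) (hu : IsSolution c 1 C u) (x : X) :
    Continuous fun y => peierlsBarrier c C y x := by
  have hcb := IsBoundedFun.of_continuous hc
  rw [Metric.continuous_iff]
  intro y ε hε
  obtain ⟨δ, hδ, h⟩ := exists_modulus hc (ε := ε / 3) (by positivity)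
  have key : ∀ y z, dist y z < δ →
      peierlsBarrier c C y x ≤ peierlsBarrier c C z x + (ε / 3 + ε / 3) := by
    intro y z hyz
    refine peierlsBarrier_le_of_frequently hcb hu (frequently_atTop.2 fun N => ?_)
    obtain ⟨n, hN, hn, h1⟩ := exists_chainCost_lt hc hu
      (lt_add_of_pos_right (peierlsBarrier c C z x) (show 0 < ε / 3 by positivity)) N
    have := chainCost_le_add_left hcb hn (fun t => (h y z hyz t).1) x
    exact ⟨n, hN, by linarith⟩
  refine ⟨δ, hδ, fun z hz => ?_⟩
  have h1 := key z y hz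
  have h2 := key y z (by rwa [dist_comm])
  rw [Real.dist_eq, abs_sub_lt_iff]
  exact ⟨by linarith, by linarith⟩

/-- Every point is reached in a calibrated way from a point of the Aubry set. -/
lemma exists_aubry_calibrated (hc : Continuous c) (hu : IsSolution c 1 C u) (x : X) :
    ∃ y, peierlsBarrier c C y y ≤ 0 ∧ u y + peierlsBarrier c C y x ≤ u x := by
  choose g hg using fun x => hu.exists_calibrated hc x
  simp only [one_mul] at hg
  have hcb := IsBoundedFun.of_continuous hc
  obtain ⟨y, φ, hφ, hy⟩ := CompactSpace.tendsto_subseq fun n => g^[n] x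
  have huy : Tendsto (fun k => u (g^[φ k] x)) atTop (𝓝 (u y)) :=
    ((hu.continuous hc).tendsto y).comp hy
  have hev : ∀ ε > 0, ∀ᶠ k in atTop, 1 ≤ φ k ∧ |u (g^[φ k] x) - u y| < ε ∧
      ∀ t, |c (y, t) - c (g^[φ k] x, t)| < ε ∧ |c (t, y) - c (t, g^[φ k] x)| < ε := by
    intro ε hε
    obtain ⟨δ, hδ, h⟩ := exists_modulus hc hε
    filter_upwards [hφ.tendsto_atTop.eventually_ge_atTop 1, Metric.tendsto_nhds.1 huy ε hε,
      Metric.tendsto_nhds.1 hy δ hδ] with k h1 h2 h3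
    exact ⟨h1, by rwa [← Real.dist_eq], h _ _ (by rwa [dist_comm])⟩
  refine ⟨y, le_of_forall_pos_le_add fun ε hε => ?_, ?_⟩
  -- Close up the orbit segment between two visits near `y`: two endpoint moves and two errors in
  -- `u`, each below `ε / 4`. The later visit is taken far enough for the length to exceed `N`.
  · have hε' : 0 < ε / 4 := by positivity
    obtain ⟨k₀, hk₀⟩ := eventually_atTop.1 (hev _ hε')
    obtain ⟨-, h1, h2⟩ := hk₀ k₀ le_rfl
    refine peierlsBarrier_le_of_frequently hcb hu (frequently_atTop.2 fun N => ?_)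
    obtain ⟨k, hk, hkN⟩ := ((eventually_ge_atTop k₀).and
      (hφ.tendsto_atTop.eventually_ge_atTop (φ k₀ + N + 1))).exists
    obtain ⟨-, h3, h4⟩ := hk₀ k hk
    obtain ⟨n, hn⟩ := Nat.exists_eq_add_of_le' (show φ k₀ ≤ φ k by omega)
    have hn1 : 1 ≤ n := by omega
    refine ⟨n, by omega, ?_⟩
    have h5 := chainCost_iterate_le hcb hg hn1 (g^[φ k₀] x)
    rw [← Function.iterate_add_apply, ← hn] at h5
    have h6 := chainCost_le_add_left hcb hn1 (fun t => (h4 t).1) y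
    have h7 := chainCost_le_add_right hcb hn1 (fun t => (h2 t).2) (g^[φ k] x)
    have h8 := abs_lt.1 h1
    have h9 := abs_lt.1 h3
    linarith
  · refine le_of_forall_pos_le_add fun ε hε => ?_
    suffices peierlsBarrier c C y x ≤ u x - u y + ε by linarith
    refine peierlsBarrier_le_of_frequently hcb hu (hφ.tendsto_atTop.frequently
      ((hev _ (half_pos hε)).mono fun k hk => ?_).frequently)
    obtain ⟨hk1, h1, h2⟩ := hk
    have h3 := chainCost_iterate_le hcb hg hk1 x
    have h4 := chainCost_le_add_left hcb hk1 (fun t => (h2 t).1) x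
    have h5 := abs_lt.1 h1
    linarith

end Peierls

/-! ### Limits of discounted solutions and the barrier formula -/

section Convergence

variable {X : Type*} [MetricSpace X] [CompactSpace X] [Nonempty X] [MeasurableSpace X]
  [BorelSpace X] {c : X × X → ℝ} {C : ℝ} {u : X → ℝ}

/-- Limits of the discounted solutions are constrained subsolutions. -/
lemma mem_constrainedSubsolutions_of_tendsto (hc : Continuous c) {ι : Type*} {lam : ι → ℝ}
    (hlam : ∀ i, lam i ∈ Ioo (0 : ℝ) 1) {v : ι → X → ℝ}
    (hv : ∀ i, IsSolution c (lam i) C (v i)) {l : Ultrafilter ι} (hl : Tendsto lam l (𝓝 1))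
    (hu : ∀ x, Tendsto (fun i => v i x) l (𝓝 (u x))) : u ∈ constrainedSubsolutions c C := by
  have hsol := isSolution_of_tendsto hc hv hl tendsto_const_nhds hu
  have hunif := tendstoUniformly_of_isSolution hc hv hu
  have hcu := hsol.continuous hc
  refine ⟨hcu, hsol.isSubsolution (.of_continuous hc), fun μ hμ => ?_⟩
  have := hμ.isProbabilityMeasure
  rw [integral_map_fst hcu]
  refine le_of_forall_pos_le_add fun ε hε => ?_
  obtain ⟨i, hi⟩ := (Metric.tendstoUniformly_iff.1 hunif ε hε).exists
  have hvc := (hv i).continuous hc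
  have h1 : ∫ p, u p.1 ∂μ ≤ ∫ p, (v i p.1 + ε) ∂μ :=
    integral_mono (integrable_of_continuous (by fun_prop)) (integrable_of_continuous (by fun_prop))
      fun p => by
        have := (abs_lt.1 ((Real.dist_eq _ _).symm.trans_lt (hi p.1))).2
        dsimp only
        linarith
  rw [integral_add (integrable_of_continuous (by fun_prop)) (integrable_const _)] at h1
  simp only [integral_const, probReal_univ, one_smul] at h1
  linarith [hμ.integral_nonpos hc (hlam i) (hv i)]

lemma integrable_peierlsBarrier (hc : Continuous c) (hu : IsSolution c 1 C u)
    {μ : Measure (X × X)} (hμ : IsMatherMeasure c C μ) (x : X) :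
    Integrable (fun y => peierlsBarrier c C y x) (μ.map Prod.fst) := by
  have := hμ.isProbabilityMeasure
  have : IsProbabilityMeasure (μ.map Prod.fst) :=
    Measure.isProbabilityMeasure_map measurable_fst.aemeasurable
  exact integrable_of_continuous (continuous_peierlsBarrier_left hc hu x)

lemma le_integral_peierlsBarrier (hc : Continuous c) (hu : IsSolution c 1 C u)
    (hmem : u ∈ constrainedSubsolutions c C) {μ : Measure (X × X)} (hμ : IsMatherMeasure c C μ)
    (x : X) : u x ≤ ∫ y, peierlsBarrier c C y x ∂(μ.map Prod.fst) := by
  have := hμ.isProbabilityMeasure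
  have : IsProbabilityMeasure (μ.map Prod.fst) :=
    Measure.isProbabilityMeasure_map measurable_fst.aemeasurable
  have hi : Integrable u (μ.map Prod.fst) := integrable_of_continuous hmem.1
  have h1 : ∫ y, (u x - u y) ∂(μ.map Prod.fst) ≤ ∫ y, peierlsBarrier c C y x ∂(μ.map Prod.fst) :=
    integral_mono ((integrable_const _).sub hi) (integrable_peierlsBarrier hc hu hμ x)
      fun y => hmem.2.1.sub_le_peierlsBarrier hc hu y x
  rw [integral_sub (integrable_const _) hi] at h1
  simp only [integral_const, probReal_univ, one_smul] at h1
  linarith [hmem.2.2 μ hμ]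

lemma isLeast_integral_peierlsBarrier (hc : Continuous c) (hu : IsSolution c 1 C u)
    (hmem : u ∈ constrainedSubsolutions c C)
    (hM : ∀ x, ∃ μ, IsMatherMeasure c C μ ∧ ∀ w, Continuous w → IsSubsolution c C w →
      w x - ∫ y, w y ∂(μ.map Prod.fst) ≤ u x) (x : X) :
    IsLeast {t : ℝ | ∃ μ : Measure (X × X), IsMatherMeasure c C μ ∧
      t = ∫ y, peierlsBarrier c C y x ∂(μ.map Prod.fst)} (u x) := by
  constructor
  · obtain ⟨y, hyy, hyx⟩ := exists_aubry_calibrated hc hu x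
    -- The measure is taken at the Aubry point `y`, not at `x`, so that `h (y, y) ≤ 0` can be used.
    obtain ⟨μ, hμ, hle⟩ := hM y
    refine ⟨μ, hμ, le_antisymm (le_integral_peierlsBarrier hc hu hmem hμ x) ?_⟩
    have := hμ.isProbabilityMeasure
    have : IsProbabilityMeasure (μ.map Prod.fst) :=
      Measure.isProbabilityMeasure_map measurable_fst.aemeasurable
    have h1 := hle _ (continuous_peierlsBarrier_left hc hu y).neg
      (isSubsolution_neg_peierlsBarrier hc hu y)
    simp only [Pi.neg_apply] at h1
    rw [integral_neg] at h1
    have h2 : ∫ z, peierlsBarrier c C z x ∂(μ.map Prod.fst) ≤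
        ∫ z, (peierlsBarrier c C z y + peierlsBarrier c C y x) ∂(μ.map Prod.fst) :=
      integral_mono (integrable_peierlsBarrier hc hu hμ x)
        ((integrable_peierlsBarrier hc hu hμ y).add (integrable_const _))
        fun z => peierlsBarrier_triangle hc hu z y x
    rw [integral_add (integrable_peierlsBarrier hc hu hμ y) (integrable_const _)] at h2
    simp only [integral_const, probReal_univ, one_smul] at h2
    linarith
  · rintro _ ⟨μ, hμ, rfl⟩
    exact le_integral_peierlsBarrier hc hu hmem hμ x

end Convergence

end WeakKAM

/-! ### The main theorem -/

open WeakKAM in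
theorem mainTheorem1 {X : Type*} [MetricSpace X] [CompactSpace X] [Nonempty X]
    [MeasurableSpace X] [BorelSpace X] (c : X × X → ℝ) (hc : Continuous c) :
    (∃! C : ℝ, WeakKAM.IsCriticalValue c C) ∧
    (∀ lam ∈ Set.Ioo (0 : ℝ) 1, ∃! u : X → ℝ, WeakKAM.IsDiscountedSolution c lam u) ∧
    ∀ c₀ : ℝ, WeakKAM.IsCriticalValue c c₀ →
      ∃ u₁ : X → ℝ,
        WeakKAM.IsWeakKAMSolution c c₀ u₁ ∧
        (∀ U : ℝ → X → ℝ,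
          (∀ lam ∈ Set.Ioo (0 : ℝ) 1, WeakKAM.IsDiscountedSolution c lam (U lam)) →
          TendstoUniformly (fun (lam : ℝ) (x : X) => U lam x + c₀ / (1 - lam)) u₁ (𝓝[<] 1)) ∧
        (∀ x : X, IsLUB {t : ℝ | ∃ w ∈ WeakKAM.constrainedSubsolutions c c₀, t = w x} (u₁ x)) ∧
        (∀ (μ : Measure (X × X)), WeakKAM.IsMatherMeasure c c₀ μ → ∀ x : X,
          Integrable (fun y => WeakKAM.peierlsBarrier c c₀ y x) (μ.map Prod.fst)) ∧
        (∀ x : X, IsLeast {t : ℝ | ∃ μ : Measure (X × X), WeakKAM.IsMatherMeasure c c₀ μ ∧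
          t = ∫ y, WeakKAM.peierlsBarrier c c₀ y x ∂(μ.map Prod.fst)} (u₁ x)) := by
  have hcb := IsBoundedFun.of_continuous hc
  have huniq : ∀ lam ∈ Ioo (0 : ℝ) 1, ∀ u w, IsDiscountedSolution c lam u →
      IsDiscountedSolution c lam w → u = w := fun lam hlam u w hu hw =>
    (isSolution_zero_iff.2 hu).unique hcb hlam (isSolution_zero_iff.2 hw)
  refine ⟨?_, fun lam hlam => ?_, fun C ⟨u₀, hu₀⟩ => ?_⟩
  · obtain ⟨C, u, hu⟩ := exists_isCriticalValue hc
    refine ⟨C, ⟨u, hu⟩, fun C' ⟨u', hu'⟩ => ?_⟩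
    rw [← isSolution_one_iff] at hu hu'
    exact le_antisymm (hu.le_critical hcb hu') (hu'.le_critical hcb hu)
  · obtain ⟨u, hu⟩ := exists_isDiscountedSolution hc hlam
    exact ⟨u, hu, fun w hw => huniq lam hlam w u hw hu⟩
  rw [← isSolution_one_iff] at hu₀
  choose V hV using fun lam : Ioo (0 : ℝ) 1 => exists_isDiscountedSolution hc lam.2
  let v : Ioo (0 : ℝ) 1 → X → ℝ := fun lam x => V lam x + C / (1 - (lam : ℝ))
  have hv : ∀ lam : Ioo (0 : ℝ) 1, IsSolution c lam C (v lam) := fun lam =>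
    (hV lam).isSolution_add hc lam.2 C
  obtain ⟨K, hK⟩ := hu₀.1
  have hbd : ∀ lam x, |v lam x| ≤ 2 * K := fun lam x =>
    hu₀.abs_le_two_mul hcb lam.2 hK (hv lam) x
  let l₀ : Filter (Ioo (0 : ℝ) 1) := comap (↑) (𝓝[<] (1 : ℝ))
  have htend : ∀ l : Ultrafilter (Ioo (0 : ℝ) 1), ↑l ≤ l₀ →
      Tendsto ((↑) : Ioo (0 : ℝ) 1 → ℝ) l (𝓝 1) := fun l hl =>
    (tendsto_comap.mono_left hl).mono_right nhdsWithin_le_nhds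
  have hlim : ∀ l : Ultrafilter (Ioo (0 : ℝ) 1), ∃ f : X → ℝ,
      ∀ x, Tendsto (fun lam => v lam x) l (𝓝 (f x)) := fun l =>
    ⟨_, fun x => (exists_tendsto_of_abs_le l fun lam => hbd lam x).choose_spec⟩
  obtain ⟨u, hu⟩ := hlim (Ultrafilter.of l₀)
  have hl := htend _ (Ultrafilter.of_le l₀)
  have hsol : IsSolution c 1 C u := isSolution_of_tendsto hc hv hl tendsto_const_nhds hu
  have hmem : ∀ l : Ultrafilter (Ioo (0 : ℝ) 1), ↑l ≤ l₀ → ∀ f : X → ℝ,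
      (∀ x, Tendsto (fun lam => v lam x) l (𝓝 (f x))) → f ∈ constrainedSubsolutions c C :=
    fun l hl f hf => mem_constrainedSubsolutions_of_tendsto hc Subtype.prop hv (htend l hl) hf
  have hmax : ∀ l : Ultrafilter (Ioo (0 : ℝ) 1), ↑l ≤ l₀ → ∀ f : X → ℝ,
      (∀ x, Tendsto (fun lam => v lam x) l (𝓝 (f x))) →
      ∀ w ∈ constrainedSubsolutions c C, ∀ x, w x ≤ f x := by
    intro l hl f hf w hw x
    obtain ⟨μ, hμ, h⟩ := exists_isMatherMeasure_le hc Subtype.prop hv (htend l hl) (hf x)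
    linarith [h w hw.1 hw.2.1, hw.2.2 μ hμ]
  have hu_mem := hmem _ (Ultrafilter.of_le l₀) u hu
  have hu_max := hmax _ (Ultrafilter.of_le l₀) u hu
  -- Any two ultrafilter limits are constrained subsolutions dominating each other.
  have hconv : ∀ x, Tendsto (fun lam => v lam x) l₀ (𝓝 (u x)) := by
    intro x
    rw [tendsto_iff_ultrafilter]
    intro l hl
    obtain ⟨f, hf⟩ := hlim l
    have : f x = u x := le_antisymm (hu_max f (hmem l hl f hf) x) (hmax l hl f hf u hu_mem x)
    rw [← this]
    exact hf x
  refine ⟨u, isSolution_one_iff.1 hsol, fun U hU => ?_, fun x => ?_,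
    fun μ hμ x => integrable_peierlsBarrier hc hsol hμ x,
    isLeast_integral_peierlsBarrier hc hsol hu_mem fun x =>
      exists_isMatherMeasure_le hc Subtype.prop hv hl (hu x)⟩
  -- `U` is only controlled on `Ioo 0 1`, where uniqueness identifies it with `V`; this set belongs
  -- to `𝓝[<] 1`.
  · have hmap : map ((↑) : Ioo (0 : ℝ) 1 → ℝ) l₀ = 𝓝[<] 1 :=
      map_comap_of_mem (by rw [Subtype.range_coe]; exact Ioo_mem_nhdsLT zero_lt_one)
    have hunif := tendstoUniformly_of_isSolution hc hv hconv
    rw [Metric.tendstoUniformly_iff] at hunif ⊢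
    intro ε hε
    rw [← hmap, eventually_map]
    refine (hunif ε hε).mono fun lam h x => ?_
    rw [huniq lam lam.2 _ _ (hU lam lam.2) (hV lam)]
    exact h x
  · refine ⟨?_, fun b hb => hb ⟨u, hu_mem, rfl⟩⟩
    rintro _ ⟨w, hw, rfl⟩
    exact hu_max w hw x
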